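/- A semi-metric on a set $X$ is a function $d_X:X\times X\to[0,\infty)$ with $d_X(x,y)=d_X(y,x)$ and $d_X(x,y)=0$ if and only if $x=y$. Let $\mathcal{O}_m(\mathbb{R})$ denote the set of real symmetric positive semidefinite $m\times m$ matrices $Q$ with $Q\mathbf{1}=0$, where $\mathbf{1}$ is the all-ones vector. Let $0\le p<\infty$ and $1\le C<\infty$. A semi-metric space $(X,d_X)$ is said to have $p$-negative type with distortion $C$ if $$\sum_{q_{ij}>0}d_X(x_i,x_j)^p q_{ij}+C^2\sum_{q_{ij}<0}d_X(x_i,x_j)^p q_{ij}\le 0$$ for all $m\ge 2$, all distinct $x_1,\dots,x_m\in X$ and all $Q=(q_{ij})_{i,j=1}^m\in\mathcal{O}_m(\mathbb{R})$; it is said to have strict $p$-negative type with distortion $C$ if, in addition, equality holds only for $Q=0$. Here $d_X(x,x)^p=0$ for every $p\ge 0$, that is, the convention $0^0=0$ is used for $p=0$. **Corollary 4.9.** Let $n\ge 2$ and let $H_n$ be the Hamming cube, that is, the set $\{0,1\}^n$ with the metric $d(x,y)=\sum_{i=1}^n|x_i-y_i|$. Let $0\le p<\infty$ and $1\le C<\infty$.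 Then $H_n$ has strict $p$-negative type with distortion $C$ if and only if either $0\le p<1$, or $p\ge 1$ and $$C>n^{(p-1)/2}.$$ -/

import Mathlib

/-- A semi-metric on `X`: a metric without the requirement of the triangle inequality. -/
structure SemiMetric (X : Type*) where
  /-- The distance function. -/
  dist : X → X → ℝ
  dist_nonneg : ∀ x y, 0 ≤ dist x y
  dist_eq_zero : ∀ x y, dist x y = 0 ↔ x = y
  dist_symm : ∀ x y, dist x y = dist y x

open Classical in
/-- The `p`-th power `d(x, y) ^ p` of a semi-metric. Its value on the diagonal is `0` for every
`p ≥ 0`: for `p > 0` this is `0 ^ p = 0`, and for `p = 0` it is the convention that makes `d ^ 0`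
again a semi-metric (the discrete one). Lean's real power has `0 ^ 0 = 1`, hence the case split. -/
noncomputable def SemiMetric.distPow {X : Type*} (d : SemiMetric X) (p : ℝ) (x y : X) : ℝ :=
  if x = y then 0 else d.dist x y ^ p

/-- The set `𝒪ₙ(ℝ)` of real symmetric positive semidefinite `n × n` matrices `Q` with `Q 𝟙 = 0`,
where `𝟙` is the all-ones vector. -/
def nullSumPosSemidef (n : ℕ) : Set (Matrix (Fin n) (Fin n) ℝ) :=
  {Q | Q.PosSemidef ∧ Q.mulVec (fun _ => 1) = 0}

open Classical in
/-- The expression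
`∑_{q_{ij} > 0} d(x_i, x_j) ^ p q_{ij} + C ^ 2 ∑_{q_{ij} < 0} d(x_i, x_j) ^ p q_{ij}`. -/
noncomputable def SemiMetric.distortedSum {X : Type*} (d : SemiMetric X) (p C : ℝ) {n : ℕ}
    (x : Fin n → X) (Q : Matrix (Fin n) (Fin n) ℝ) : ℝ :=
  (∑ i, ∑ j, if 0 < Q i j then d.distPow p (x i) (x j) * Q i j else 0) +
    C ^ 2 * ∑ i, ∑ j, if Q i j < 0 then d.distPow p (x i) (x j) * Q i j else 0

/-- `p`-negative type with distortion `C` (meant for `0 ≤ p` and `1 ≤ C`). -/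
def SemiMetric.HasNegType {X : Type*} (d : SemiMetric X) (p C : ℝ) : Prop :=
  ∀ n : ℕ, 2 ≤ n → ∀ x : Fin n → X, Function.Injective x →
    ∀ Q ∈ nullSumPosSemidef n, d.distortedSum p C x Q ≤ 0

/-- Strict `p`-negative type with distortion `C`: `p`-negative type with distortion `C`, with
equality in the defining inequality only for `Q = 0`. -/
def SemiMetric.HasStrictNegType {X : Type*} (d : SemiMetric X) (p C : ℝ) : Prop :=
  d.HasNegType p C ∧
    ∀ n : ℕ, 2 ≤ n → ∀ x : Fin n → X, Function.Injective x →
      ∀ Q ∈ nullSumPosSemidef n, d.distortedSum p C x Q = 0 → Q = 0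

/-- The Hamming cube `H_n`: the set `{0, 1}^n` with `d(x, y) = ∑ i, |x_i - y_i|`. -/
def hammingCube (n : ℕ) : SemiMetric (Fin n → Fin 2) where
  dist x y := ∑ i, |((x i : ℕ) : ℝ) - ((y i : ℕ) : ℝ)|
  dist_nonneg _ _ := Finset.sum_nonneg fun _ _ => abs_nonneg _
  dist_eq_zero x y := by
    rw [Finset.sum_eq_zero_iff_of_nonneg fun _ _ => abs_nonneg _]
    simp only [Finset.mem_univ, forall_true_left, abs_eq_zero, sub_eq_zero, Nat.cast_inj,
      Fin.val_inj]
    exact funext_iff.symm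
  dist_symm _ _ := Finset.sum_congr rfl fun _ _ => abs_sub_comm _ _

/-! Identify the cube with the group `𝔽₂ⁿ`: `d(x, y) ^ p` depends only on `x + y`, so Walsh
characters diagonalise the sums (`sum_translation_kernel`).

For `p < 1` every nontrivial Walsh coefficient of the weight to the power `p` is negative, because
the increments of `t ^ p` are completely monotone. The trivial coefficient is killed by `Q 𝟙 = 0`,
and `C ≥ 1` only helps.

For `p ≥ 1`, weights from 1 to `n` satisfy `w ≤ w ^ p ≤ n ^ (p - 1) * w`. Let `P_p` and `N_p` be the
positive and negative parts of the sum. Since `P_1 ≤ N_1`, it follows that `P_p - C² N_p ≤ -(C² - n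
^ (p - 1)) N_1`.

The threshold is sharp: take all points of the cube and `Q` with entry `n - 1` on the diagonal, `-1`
on edges and `1` between antipodes (`diagonalKernel`). Each row contributes at least `n ^ p - C² n`.
-/

/-! ### Fourier analysis on the cube -/

/-- The nontrivial sign character of `Fin 2`. -/
noncomputable def bitSign (a : Fin 2) : ℝ := if a = 0 then 1 else -1

/-- The Walsh character of the cube indexed by `S`. -/
noncomputable def walsh {n : ℕ} (S x : Fin n → Fin 2) : ℝ := ∏ i, bitSign (S i * x i)

/-- The Walsh transform of a function on the cube. -/
noncomputable def walshTransform {n : ℕ} (g : (Fin n → Fin 2) → ℝ) (S : Fin n → Fin 2) : ℝ :=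
  ∑ y, g y * walsh S y

/-- The Hamming weight. -/
def hammingWeight {n : ℕ} (u : Fin n → Fin 2) : ℕ := ∑ i, (u i : ℕ)

lemma bitSign_zero : bitSign 0 = 1 := by simp [bitSign]

lemma bitSign_mul_add (s a b : Fin 2) :
    bitSign (s * (a + b)) = bitSign (s * a) * bitSign (s * b) := by
  fin_cases s <;> fin_cases a <;> fin_cases b <;> simp [bitSign]

lemma walsh_add {n : ℕ} (S x y : Fin n → Fin 2) : walsh S (x + y) = walsh S x * walsh S y := by
  simp only [walsh, ← Finset.prod_mul_distrib, Pi.add_apply, bitSign_mul_add]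

lemma walsh_zero_left {n : ℕ} (x : Fin n → Fin 2) : walsh 0 x = 1 := by
  simp [walsh, bitSign_zero]

lemma walsh_zero_right {n : ℕ} (S : Fin n → Fin 2) : walsh S 0 = 1 := by
  simp [walsh, bitSign_zero]

lemma fin_two_add_self (a : Fin 2) : a + a = 0 := by
  fin_cases a <;> rfl

lemma cube_add_self {n : ℕ} (x : Fin n → Fin 2) : x + x = 0 :=
  funext fun i => fin_two_add_self (x i)

lemma cube_add_eq_zero_iff {n : ℕ} (x y : Fin n → Fin 2) : x + y = 0 ↔ x = y := by
  refine ⟨fun h => ?_, fun h => h ▸ cube_add_self x⟩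
  have : x + y + y = y := by rw [h, zero_add]
  rwa [add_assoc, cube_add_self, add_zero] at this

lemma sum_walsh {n : ℕ} (x : Fin n → Fin 2) :
    ∑ S, walsh S x = if x = 0 then (2 : ℝ) ^ n else 0 := by
  have h : ∑ S, walsh S x = ∏ i, ∑ s : Fin 2, bitSign (s * x i) := by
    rw [Finset.prod_univ_sum, Fintype.piFinset_univ]
    rfl
  rw [h]
  split_ifs with hx
  · subst hx
    simp [bitSign_zero]
  · obtain ⟨i, hi⟩ := Function.ne_iff.mp hx
    refine Finset.prod_eq_zero (Finset.mem_univ i) ?_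
    have : x i = 1 := by
      have := (x i).isLt
      have h0 : (x i : ℕ) ≠ 0 := fun h => hi (Fin.ext h)
      exact Fin.ext (by simp; omega)
    simp [this, bitSign]

lemma walsh_inversion {n : ℕ} (g : (Fin n → Fin 2) → ℝ) (u : Fin n → Fin 2) :
    ∑ S, walshTransform g S * walsh S u = 2 ^ n * g u := by
  simp only [walshTransform, Finset.sum_mul]
  rw [Finset.sum_comm]
  have h : ∀ y, ∑ S, g y * walsh S y * walsh S u = if y = u then 2 ^ n * g u else 0 := by
    intro y
    simp only [mul_assoc, ← walsh_add, ← Finset.mul_sum, sum_walsh, cube_add_eq_zero_iff]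
    split_ifs with h
    · rw [h, mul_comm]
    · simp
  simp [h]

/-- The quadratic form of `Q` at the vector of values of a Walsh character. -/
noncomputable def walshForm {n m : ℕ} (x : Fin m → Fin n → Fin 2)
    (Q : Matrix (Fin m) (Fin m) ℝ) (S : Fin n → Fin 2) : ℝ :=
  ∑ i, ∑ j, walsh S (x i) * walsh S (x j) * Q i j

lemma quadForm_nonneg {m : ℕ} {Q : Matrix (Fin m) (Fin m) ℝ} (hQ : Q.PosSemidef)
    (v : Fin m → ℝ) : 0 ≤ ∑ i, ∑ j, v i * v j * Q i j := by
  have h := hQ.dotProduct_mulVec_nonneg v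
  have e : star v ⬝ᵥ Q.mulVec v = ∑ i, ∑ j, v i * v j * Q i j := by
    simp only [dotProduct, Matrix.mulVec, Finset.mul_sum, star_trivial]
    exact Finset.sum_congr rfl fun i _ => Finset.sum_congr rfl fun j _ => by ring
  rwa [e] at h

lemma walshForm_nonneg {n m : ℕ} (x : Fin m → Fin n → Fin 2)
    {Q : Matrix (Fin m) (Fin m) ℝ} (hQ : Q.PosSemidef) (S : Fin n → Fin 2) :
    0 ≤ walshForm x Q S :=
  quadForm_nonneg hQ fun i => walsh S (x i)

lemma row_sum_eq_zero {m : ℕ} {Q : Matrix (Fin m) (Fin m) ℝ}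
    (hQ : Q ∈ nullSumPosSemidef m) (i : Fin m) : ∑ j, Q i j = 0 := by
  simpa [Matrix.mulVec, dotProduct] using congrFun hQ.2 i

lemma walshForm_zero {n m : ℕ} (x : Fin m → Fin n → Fin 2)
    {Q : Matrix (Fin m) (Fin m) ℝ} (hQ : Q ∈ nullSumPosSemidef m) : walshForm x Q 0 = 0 := by
  simp [walshForm, walsh_zero_left, row_sum_eq_zero hQ]

/-- Expand `g` by Walsh inversion; multiplicativity of characters separates `x i` from `x j`. -/
lemma sum_translation_kernel {n m : ℕ} (x : Fin m → Fin n → Fin 2)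
    (Q : Matrix (Fin m) (Fin m) ℝ) (g : (Fin n → Fin 2) → ℝ) :
    2 ^ n * ∑ i, ∑ j, g (x i + x j) * Q i j = ∑ S, walshTransform g S * walshForm x Q S := by
  simp only [walshForm, Finset.mul_sum]
  symm
  rw [Finset.sum_comm]
  refine Finset.sum_congr rfl fun i _ => ?_
  rw [Finset.sum_comm]
  refine Finset.sum_congr rfl fun j _ => ?_
  symm
  rw [← mul_assoc, ← walsh_inversion, Finset.sum_mul]
  exact Finset.sum_congr rfl fun S _ => by rw [walsh_add]; ring

/-- For the delta function at the origin, the kernel formula computes the trace, as the points are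
distinct. A positive semidefinite matrix of trace zero vanishes. -/
lemma eq_zero_of_walshForm_eq_zero {n m : ℕ} {x : Fin m → Fin n → Fin 2}
    (hx : Function.Injective x) {Q : Matrix (Fin m) (Fin m) ℝ} (hQ : Q.PosSemidef)
    (h : ∀ S, walshForm x Q S = 0) : Q = 0 := by
  have h1 := sum_translation_kernel x Q fun u => if u = 0 then 1 else 0
  simp only [h, mul_zero, Finset.sum_const_zero, cube_add_eq_zero_iff, hx.eq_iff, ite_mul, one_mul,
    zero_mul, Finset.sum_ite_eq, Finset.mem_univ, if_true] at h1
  have h2 : Q.trace = 0 := by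
    rcases mul_eq_zero.mp h1 with h | h
    · exact absurd h (by positivity)
    · exact h
  exact hQ.trace_eq_zero_iff.mp h2

/-! ### The powers of the Hamming distance -/

lemma hammingWeight_eq_zero_iff {n : ℕ} (u : Fin n → Fin 2) : hammingWeight u = 0 ↔ u = 0 := by
  simp only [hammingWeight, Finset.sum_eq_zero_iff, Finset.mem_univ, forall_true_left, funext_iff,
    Pi.zero_apply, Fin.ext_iff, Fin.val_zero]

lemma hammingWeight_le {n : ℕ} (u : Fin n → Fin 2) : hammingWeight u ≤ n := by
  calc hammingWeight u ≤ ∑ _i : Fin n, 1 :=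
        Finset.sum_le_sum fun i _ => Nat.lt_succ_iff.mp (u i).isLt
    _ = n := by simp

lemma hammingCube_dist {n : ℕ} (x y : Fin n → Fin 2) :
    (hammingCube n).dist x y = hammingWeight (x + y) := by
  simp only [hammingCube, hammingWeight, Nat.cast_sum, Pi.add_apply]
  refine Finset.sum_congr rfl fun i _ => ?_
  generalize x i = a
  generalize y i = b
  fin_cases a <;> fin_cases b <;> simp

/-- The `p`-th power of the Hamming distance to the origin. -/
noncomputable def weightPow {n : ℕ} (p : ℝ) (u : Fin n → Fin 2) : ℝ :=
  if u = 0 then 0 else (hammingWeight u : ℝ) ^ p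

lemma hammingCube_distPow {n : ℕ} (p : ℝ) (x y : Fin n → Fin 2) :
    (hammingCube n).distPow p x y = weightPow p (x + y) := by
  simp only [SemiMetric.distPow, weightPow, cube_add_eq_zero_iff, hammingCube_dist]

lemma weightPow_nonneg {n : ℕ} (p : ℝ) (u : Fin n → Fin 2) : 0 ≤ weightPow p u := by
  unfold weightPow
  split_ifs <;> positivity

lemma weightPow_pos {n : ℕ} (p : ℝ) {u : Fin n → Fin 2} (hu : u ≠ 0) : 0 < weightPow p u := by
  have : 0 < hammingWeight u := Nat.pos_of_ne_zero (mt (hammingWeight_eq_zero_iff u).mp hu)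
  rw [weightPow, if_neg hu]
  positivity

lemma weightPow_one_le {n : ℕ} {p : ℝ} (hp : 1 ≤ p) (u : Fin n → Fin 2) :
    weightPow 1 u ≤ weightPow p u := by
  unfold weightPow
  split_ifs with hu
  · rfl
  · have : 1 ≤ hammingWeight u := Nat.pos_of_ne_zero (mt (hammingWeight_eq_zero_iff u).mp hu)
    exact Real.rpow_le_rpow_of_exponent_le (by exact_mod_cast this) hp

lemma weightPow_le {n : ℕ} {p : ℝ} (hp : 1 ≤ p) (u : Fin n → Fin 2) :
    weightPow p u ≤ (n : ℝ) ^ (p - 1) * weightPow 1 u := by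
  unfold weightPow
  split_ifs with hu
  · simp
  · have h : 0 < hammingWeight u := Nat.pos_of_ne_zero (mt (hammingWeight_eq_zero_iff u).mp hu)
    have h' : (0 : ℝ) < hammingWeight u := by exact_mod_cast h
    calc (hammingWeight u : ℝ) ^ p =
          (hammingWeight u : ℝ) ^ (p - 1) * (hammingWeight u : ℝ) ^ (1 : ℝ) := by
          rw [← Real.rpow_add h']; ring_nf
      _ ≤ _ := by
          have h1 : (hammingWeight u : ℝ) ≤ n := by exact_mod_cast hammingWeight_le u
          have h2 : 0 ≤ p - 1 := by linarith
          gcongr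

/-- The part of the distorted sum with positive coefficients. -/
noncomputable def posCoeffSum {n m : ℕ} (g : (Fin n → Fin 2) → ℝ) (x : Fin m → Fin n → Fin 2)
    (Q : Matrix (Fin m) (Fin m) ℝ) : ℝ :=
  ∑ i, ∑ j, g (x i + x j) * max (Q i j) 0

/-- The part of the distorted sum with negative coefficients, with the sign changed. -/
noncomputable def negCoeffSum {n m : ℕ} (g : (Fin n → Fin 2) → ℝ) (x : Fin m → Fin n → Fin 2)
    (Q : Matrix (Fin m) (Fin m) ℝ) : ℝ :=
  ∑ i, ∑ j, g (x i + x j) * max (-Q i j) 0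

lemma distortedSum_eq {n m : ℕ} (p C : ℝ) (x : Fin m → Fin n → Fin 2)
    (Q : Matrix (Fin m) (Fin m) ℝ) :
    (hammingCube n).distortedSum p C x Q =
      posCoeffSum (weightPow p) x Q - C ^ 2 * negCoeffSum (weightPow p) x Q := by
  have h1 : ∀ a b : ℝ, (if 0 < a then b * a else 0) = b * max a 0 := by
    intro a b
    split_ifs with h
    · rw [max_eq_left h.le]
    · rw [max_eq_right (not_lt.mp h), mul_zero]
  have h2 : ∀ a b : ℝ, (if a < 0 then b * a else 0) = -(b * max (-a) 0) := by
    intro a b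
    split_ifs with h
    · rw [max_eq_left (by linarith)]; ring
    · rw [max_eq_right (by linarith), mul_zero, neg_zero]
  simp only [SemiMetric.distortedSum, h1, h2, hammingCube_distPow, posCoeffSum, negCoeffSum,
    Finset.sum_neg_distrib]
  ring

lemma posCoeffSum_sub_negCoeffSum {n m : ℕ} (g : (Fin n → Fin 2) → ℝ) (x : Fin m → Fin n → Fin 2)
    (Q : Matrix (Fin m) (Fin m) ℝ) :
    posCoeffSum g x Q - negCoeffSum g x Q = ∑ i, ∑ j, g (x i + x j) * Q i j := by
  simp only [posCoeffSum, negCoeffSum, ← Finset.sum_sub_distrib, ← mul_sub]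
  refine Finset.sum_congr rfl fun i _ => Finset.sum_congr rfl fun j _ => ?_
  congr 1
  rcases le_total 0 (Q i j) with h | h
  · rw [max_eq_left h, max_eq_right (by linarith), sub_zero]
  · rw [max_eq_right h, max_eq_left (by linarith)]; ring

lemma negCoeffSum_nonneg {n m : ℕ} (p : ℝ) (x : Fin m → Fin n → Fin 2)
    (Q : Matrix (Fin m) (Fin m) ℝ) : 0 ≤ negCoeffSum (weightPow p) x Q :=
  Finset.sum_nonneg fun _ _ => Finset.sum_nonneg fun _ _ =>
    mul_nonneg (weightPow_nonneg _ _) (le_max_right _ _)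

/-- No off-diagonal entry can be negative, and the diagonal is nonnegative by semidefiniteness; zero
row sums then force every entry to vanish. -/
lemma eq_zero_of_negCoeffSum_eq_zero {n m : ℕ} (p : ℝ) {x : Fin m → Fin n → Fin 2}
    (hx : Function.Injective x) {Q : Matrix (Fin m) (Fin m) ℝ} (hQ : Q ∈ nullSumPosSemidef m)
    (h : negCoeffSum (weightPow p) x Q = 0) : Q = 0 := by
  have hterm : ∀ i j, 0 ≤ weightPow p (x i + x j) * max (-Q i j) 0 := fun _ _ =>
    mul_nonneg (weightPow_nonneg _ _) (le_max_right _ _)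
  have hnn : ∀ i j, 0 ≤ Q i j := by
    intro i j
    by_cases hij : i = j
    · subst hij
      exact hQ.1.diag_nonneg
    · have h1 := (Finset.sum_eq_zero_iff_of_nonneg fun i _ =>
        Finset.sum_nonneg fun j _ => hterm i j).mp h i (Finset.mem_univ i)
      have h2 := (Finset.sum_eq_zero_iff_of_nonneg fun j _ => hterm i j).mp h1 j (Finset.mem_univ j)
      have h3 : 0 < weightPow p (x i + x j) :=
        weightPow_pos p fun h => hij (hx ((cube_add_eq_zero_iff _ _).mp h))
      have h4 := (mul_eq_zero.mp h2).resolve_left h3.ne'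
      linarith [le_max_left (-Q i j) 0]
  ext i j
  exact (Finset.sum_eq_zero_iff_of_nonneg fun j _ => hnn i j).mp (row_sum_eq_zero hQ i) j
    (Finset.mem_univ j)

/-! ### Exponents at least one -/

lemma hammingWeight_eq_sum_bitSign {n : ℕ} (u : Fin n → Fin 2) :
    (hammingWeight u : ℝ) = ∑ i, (1 - bitSign (u i)) / 2 := by
  simp only [hammingWeight, Nat.cast_sum]
  refine Finset.sum_congr rfl fun i _ => ?_
  generalize u i = a
  fin_cases a <;> simp [bitSign]

lemma weightPow_one {n : ℕ} (u : Fin n → Fin 2) : weightPow 1 u = hammingWeight u := by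
  unfold weightPow
  split_ifs with h
  · simp [h, hammingWeight]
  · simp

lemma bitSign_add (a b : Fin 2) : bitSign (a + b) = bitSign a * bitSign b := by
  simpa using bitSign_mul_add 1 a b

/-- The Hamming distance is a sum over coordinates of cut semi-metrics `(1 - ε_i ε_j) / 2`. The
constant drops out by `Q 𝟙 = 0`, leaving minus half a quadratic form of `Q`. -/
lemma sum_weightPow_one_nonpos {n m : ℕ} (x : Fin m → Fin n → Fin 2)
    {Q : Matrix (Fin m) (Fin m) ℝ} (hQ : Q ∈ nullSumPosSemidef m) :
    ∑ i, ∑ j, weightPow 1 (x i + x j) * Q i j ≤ 0 := by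
  have h : ∑ i, ∑ j, weightPow 1 (x i + x j) * Q i j =
      ∑ k, -((∑ i, ∑ j, bitSign (x i k) * bitSign (x j k) * Q i j) / 2) := by
    have h0 : ∀ k : Fin n, -((∑ i, ∑ j, bitSign (x i k) * bitSign (x j k) * Q i j) / 2) =
        ∑ i, ∑ j, (1 - bitSign (x i k) * bitSign (x j k)) / 2 * Q i j := by
      intro k
      have e : ∀ i j, (1 - bitSign (x i k) * bitSign (x j k)) / 2 * Q i j =
          Q i j / 2 - bitSign (x i k) * bitSign (x j k) * Q i j / 2 := fun i j => by ring
      simp only [e, Finset.sum_sub_distrib, ← Finset.sum_div, row_sum_eq_zero hQ]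
      simp
    simp only [h0]
    symm
    rw [Finset.sum_comm]
    refine Finset.sum_congr rfl fun i _ => ?_
    rw [Finset.sum_comm]
    refine Finset.sum_congr rfl fun j _ => ?_
    simp only [weightPow_one, hammingWeight_eq_sum_bitSign, Finset.sum_mul, Pi.add_apply,
      bitSign_add]
  rw [h]
  refine Finset.sum_nonpos fun k _ => ?_
  have := quadForm_nonneg hQ.1 fun i => bitSign (x i k)
  linarith

lemma hasStrictNegType_of_one_le {n : ℕ} {p C : ℝ} (hp : 1 ≤ p)
    (hC : (n : ℝ) ^ (p - 1) < C ^ 2) : (hammingCube n).HasStrictNegType p C := by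
  have key : ∀ m : ℕ, ∀ x : Fin m → Fin n → Fin 2, ∀ Q ∈ nullSumPosSemidef m,
      (hammingCube n).distortedSum p C x Q ≤
        -((C ^ 2 - (n : ℝ) ^ (p - 1)) * negCoeffSum (weightPow 1) x Q) := by
    intro m x Q hQ
    have h1 : posCoeffSum (weightPow p) x Q ≤
        (n : ℝ) ^ (p - 1) * posCoeffSum (weightPow 1) x Q := by
      simp only [posCoeffSum, Finset.mul_sum]
      refine Finset.sum_le_sum fun i _ => Finset.sum_le_sum fun j _ => ?_
      rw [← mul_assoc]
      exact mul_le_mul_of_nonneg_right (weightPow_le hp _) (le_max_right _ _)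
    have h2 : negCoeffSum (weightPow 1) x Q ≤ negCoeffSum (weightPow p) x Q :=
      Finset.sum_le_sum fun i _ => Finset.sum_le_sum fun j _ =>
        mul_le_mul_of_nonneg_right (weightPow_one_le hp _) (le_max_right _ _)
    have h3 : posCoeffSum (weightPow 1) x Q - negCoeffSum (weightPow 1) x Q ≤ 0 := by
      rw [posCoeffSum_sub_negCoeffSum]
      exact sum_weightPow_one_nonpos x hQ
    rw [distortedSum_eq]
    have h4 := mul_le_mul_of_nonneg_left h2 (sq_nonneg C)
    have h5 : (0 : ℝ) ≤ (n : ℝ) ^ (p - 1) := by positivity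
    have h6 := mul_nonpos_of_nonneg_of_nonpos h5 h3
    linarith
  have hpos : 0 < C ^ 2 - (n : ℝ) ^ (p - 1) := by linarith
  refine ⟨fun m _ x _ Q hQ => (key m x Q hQ).trans ?_, fun m _ x hx Q hQ h0 => ?_⟩
  · linarith [mul_nonneg hpos.le (negCoeffSum_nonneg 1 x Q)]
  · have h1 := key m x Q hQ
    refine eq_zero_of_negCoeffSum_eq_zero 1 hx hQ (le_antisymm ?_ (negCoeffSum_nonneg 1 x Q))
    rw [h0] at h1
    by_contra h
    linarith [mul_pos hpos (not_le.mp h)]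

/-! ### Exponents less than one -/

/-- The difference operator `f ↦ f - f (· + 1)`. -/
def diffOp (f : ℝ → ℝ) (t : ℝ) : ℝ := f t - f (t + 1)

/-- Strict complete monotonicity on the natural numbers: all alternating differences are positive. -/
def StrictlyCompletelyMonotone (f : ℝ → ℝ) : Prop := ∀ k a : ℕ, 0 < diffOp^[k] f a

lemma diffOp_iterate_add_shift (f : ℝ → ℝ) (k : ℕ) (t : ℝ) :
    diffOp^[k] (fun s => f s + f (s + 1)) t = diffOp^[k] f t + diffOp^[k] f (t + 1) := by
  induction k generalizing t with
  | zero => rfl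
  | succ k ih => simp only [Function.iterate_succ_apply', diffOp, ih]; ring

lemma diffOp_iterate_neg (f : ℝ → ℝ) (k : ℕ) (t : ℝ) :
    diffOp^[k] (fun s => -f s) t = -diffOp^[k] f t := by
  induction k generalizing t with
  | zero => rfl
  | succ k ih => simp only [Function.iterate_succ_apply', diffOp, ih]; ring

lemma diffOp_iterate_const_mul (c : ℝ) (f : ℝ → ℝ) (k : ℕ) (t : ℝ) :
    diffOp^[k] (fun s => c * f s) t = c * diffOp^[k] f t := by
  induction k generalizing t with
  | zero => rfl
  | succ k ih => simp only [Function.iterate_succ_apply', diffOp, ih]; ring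

lemma StrictlyCompletelyMonotone.add_shift {f : ℝ → ℝ} (hf : StrictlyCompletelyMonotone f) :
    StrictlyCompletelyMonotone fun s => f s + f (s + 1) := by
  intro k a
  rw [diffOp_iterate_add_shift]
  exact add_pos (hf k a) (by exact_mod_cast hf k (a + 1))

lemma StrictlyCompletelyMonotone.diffOp {f : ℝ → ℝ} (hf : StrictlyCompletelyMonotone f) :
    StrictlyCompletelyMonotone (diffOp f) := fun k a => by
  simpa only [Function.iterate_succ_apply] using hf (k + 1) a

/-- Summing out the first coordinate leaves a function of the weight alone, which allows induction
on the dimension. -/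
lemma walshTransform_weight_succ {n : ℕ} (f : ℝ → ℝ) (S : Fin (n + 1) → Fin 2) :
    walshTransform (fun u => f (hammingWeight u)) S =
      walshTransform (fun u => f (hammingWeight u) + bitSign (S 0) * f (hammingWeight u + 1))
        (Fin.tail S) := by
  simp only [walshTransform]
  rw [← (Fin.consEquiv fun _ : Fin (n + 1) => Fin 2).sum_comp, Fintype.sum_prod_type,
    Fin.sum_univ_two, ← Finset.sum_add_distrib]
  refine Finset.sum_congr rfl fun u _ => ?_
  simp only [Fin.consEquiv, Equiv.coe_fn_mk, hammingWeight, walsh, Fin.sum_univ_succ,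
    Fin.prod_univ_succ, Fin.cons_zero, Fin.cons_succ, Fin.tail, mul_zero, mul_one, bitSign_zero,
    Fin.val_zero, Fin.val_one, Nat.cast_add, Nat.cast_one, zero_add, one_mul]
  rw [add_comm (1 : ℝ)]
  ring

/-- Each coordinate replaces `f` by `f + f (· + 1)` or `f - f (· + 1)`; both preserve complete
monotonicity. -/
lemma StrictlyCompletelyMonotone.walshTransform_pos {n : ℕ} {f : ℝ → ℝ}
    (hf : StrictlyCompletelyMonotone f) (S : Fin n → Fin 2) :
    0 < walshTransform (fun u => f (hammingWeight u)) S := by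
  induction n generalizing f with
  | zero => simpa [walshTransform, walsh, hammingWeight] using hf 0 0
  | succ n ih =>
    rw [walshTransform_weight_succ]
    by_cases h : S 0 = 0
    · rw [h, bitSign_zero]
      simpa only [one_mul] using ih hf.add_shift (Fin.tail S)
    · have : bitSign (S 0) = -1 := by simp [bitSign, h]
      rw [this]
      simpa only [_root_.diffOp, neg_one_mul, ← sub_eq_add_neg] using ih hf.diffOp (Fin.tail S)

/-- Coordinates with `S i = 0` preserve the hypothesis. The first one with `S i = 1` turns `f` into
minus its increment, to which `walshTransform_pos` applies. -/
lemma walshTransform_neg_of_diff {n : ℕ} {f : ℝ → ℝ}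
    (hf : StrictlyCompletelyMonotone fun t => f (t + 1) - f t) {S : Fin n → Fin 2} (hS : S ≠ 0) :
    walshTransform (fun u => f (hammingWeight u)) S < 0 := by
  induction n generalizing f with
  | zero => exact absurd (Subsingleton.elim _ _) hS
  | succ n ih =>
    rw [walshTransform_weight_succ]
    by_cases h : S 0 = 0
    · rw [h, bitSign_zero]
      have hT : Fin.tail S ≠ 0 := fun hT => hS <| funext fun i =>
        Fin.cases h (fun j => congrFun hT j) i
      have h2 : StrictlyCompletelyMonotone
          fun t => (f (t + 1) + f (t + 1 + 1)) - (f t + f (t + 1)) := by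
        convert hf.add_shift using 2
        ring
      simpa only [one_mul] using ih (f := fun s => f s + f (s + 1)) h2 hT
    · have : bitSign (S 0) = -1 := by simp [bitSign, h]
      rw [this]
      have h3 := hf.walshTransform_pos (Fin.tail S)
      have h4 : walshTransform (fun u => f (hammingWeight u) + -1 * f (hammingWeight u + 1))
          (Fin.tail S) =
          -walshTransform (fun u => f (hammingWeight u + 1) - f (hammingWeight u)) (Fin.tail S) := by
        simp only [walshTransform, ← Finset.sum_neg_distrib]
        exact Finset.sum_congr rfl fun u _ => by ring
      rw [h4]
      linarith

lemma hasDerivAt_diffOp_iterate {f f' : ℝ → ℝ} (h : ∀ t, 0 < t → HasDerivAt f (f' t) t) (k : ℕ)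
    {t : ℝ} (ht : 0 < t) : HasDerivAt (diffOp^[k] f) (diffOp^[k] f' t) t := by
  induction k generalizing t with
  | zero => exact h t ht
  | succ k ih =>
    simp only [Function.iterate_succ_apply']
    exact (ih ht).sub ((ih (by linarith : 0 < t + 1)).comp_add_const t 1)

lemma continuous_diffOp_iterate {f : ℝ → ℝ} (h : Continuous f) (k : ℕ) :
    Continuous (diffOp^[k] f) := by
  induction k with
  | zero => exact h
  | succ k ih =>
    simp only [Function.iterate_succ_apply']
    exact ih.sub (ih.comp (continuous_id.add continuous_const))

/-- Differences commute with differentiation, so the `k`-th difference of `s ^ q` has derivative `q`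
times that of `s ^ (q - 1)`, negative by induction over all `q < 0`. Being strictly decreasing, it
has a positive next difference. -/
lemma diffOp_iterate_rpow_pos {q : ℝ} (hq : q < 0) (k : ℕ) {t : ℝ} (ht : 0 < t) :
    0 < diffOp^[k] (fun s => s ^ q) t := by
  induction k generalizing q t with
  | zero => exact Real.rpow_pos_of_pos ht q
  | succ k ih =>
    have hd : ∀ s, 0 < s → HasDerivAt (diffOp^[k] fun s => s ^ q)
        (q * diffOp^[k] (fun s => s ^ (q - 1)) s) s := fun s hs => by
      rw [← diffOp_iterate_const_mul]
      exact hasDerivAt_diffOp_iterate (fun s hs => Real.hasDerivAt_rpow_const (Or.inl hs.ne')) k hs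
    have hanti : StrictAntiOn (diffOp^[k] fun s => s ^ q) (Set.Ioi 0) := by
      refine strictAntiOn_of_deriv_neg (convex_Ioi 0)
        (fun s hs => (hd s hs).continuousAt.continuousWithinAt) fun s hs => ?_
      rw [interior_Ioi] at hs
      rw [(hd s hs).deriv]
      exact mul_neg_of_neg_of_pos hq (ih (by linarith) hs)
    rw [Function.iterate_succ_apply', diffOp, sub_pos]
    exact hanti ht (by simp; linarith) (by linarith)

lemma strictlyCompletelyMonotone_rpow_diff {p : ℝ} (hp0 : 0 < p) (hp1 : p < 1) :
    StrictlyCompletelyMonotone fun t => (t + 1) ^ p - t ^ p := by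
  intro k a
  have hd : ∀ s, 0 < s → HasDerivAt (diffOp^[k] fun s => s ^ p)
      (p * diffOp^[k] (fun s => s ^ (p - 1)) s) s := fun s hs => by
    rw [← diffOp_iterate_const_mul]
    exact hasDerivAt_diffOp_iterate (fun s hs => Real.hasDerivAt_rpow_const (Or.inl hs.ne')) k hs
  -- The closed half-line is needed for `a = 0`, where `s ^ p` is continuous but not differentiable.
  have hmono : StrictMonoOn (diffOp^[k] fun s => s ^ p) (Set.Ici 0) := by
    refine strictMonoOn_of_deriv_pos (convex_Ici 0)
      (continuous_diffOp_iterate (Real.continuous_rpow_const hp0.le) k).continuousOn fun s hs => ?_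
    rw [interior_Ici] at hs
    rw [(hd s hs).deriv]
    exact mul_pos hp0 (diffOp_iterate_rpow_pos (by linarith) k hs)
  have h1 : (fun t : ℝ => (t + 1) ^ p - t ^ p) = fun t => -diffOp (fun s => s ^ p) t :=
    funext fun t => by simp [diffOp]
  rw [h1, diffOp_iterate_neg, ← Function.iterate_succ_apply, Function.iterate_succ_apply', diffOp,
    neg_sub, sub_pos]
  exact hmono (Set.mem_Ici.mpr a.cast_nonneg) (Set.mem_Ici.mpr (by positivity)) (by linarith)

lemma walshTransform_weightPow_neg {n : ℕ} {p : ℝ} (hp0 : 0 ≤ p) (hp1 : p < 1)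
    {S : Fin n → Fin 2} (hS : S ≠ 0) : walshTransform (weightPow p) S < 0 := by
  -- For `p = 0` the convention `0 ^ 0 = 0` gives one minus the delta function at the origin, not
  -- the real power.
  rcases hp0.eq_or_lt with rfl | hp0
  · have h1 : walshTransform (weightPow 0) S = ∑ y, walsh S y - 1 := by
      have e : ∀ y : Fin n → Fin 2, weightPow 0 y * walsh S y =
          walsh S y - if y = 0 then 1 else 0 := by
        intro y
        unfold weightPow
        split_ifs with h
        · simp [h, walsh_zero_right]
        · simp
      simp only [walshTransform, e, Finset.sum_sub_distrib]
      simp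
    have h2 : ∑ y, walsh S y = 0 := by
      have := sum_walsh S
      rw [if_neg hS] at this
      rw [← this]
      exact Finset.sum_congr rfl fun y _ => by simp only [walsh, mul_comm]
    rw [h1, h2]
    norm_num
  · have h : (weightPow p : (Fin n → Fin 2) → ℝ) =
        fun u => (fun t : ℝ => t ^ p) (hammingWeight u) := by
      funext u
      unfold weightPow
      split_ifs with hu
      · simp [hu, hammingWeight, Real.zero_rpow hp0.ne']
      · rfl
    rw [h]
    exact walshTransform_neg_of_diff (f := fun t => t ^ p)
      (strictlyCompletelyMonotone_rpow_diff hp0 hp1) hS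

lemma hasStrictNegType_of_lt_one {n : ℕ} {p C : ℝ} (hp0 : 0 ≤ p) (hp1 : p < 1) (hC : 1 ≤ C) :
    (hammingCube n).HasStrictNegType p C := by
  have hterm : ∀ m : ℕ, ∀ x : Fin m → Fin n → Fin 2, ∀ Q ∈ nullSumPosSemidef m,
      ∀ S, walshTransform (weightPow p) S * walshForm x Q S ≤ 0 := by
    intro m x Q hQ S
    by_cases hS : S = 0
    · rw [hS, walshForm_zero x hQ, mul_zero]
    · exact mul_nonpos_of_nonpos_of_nonneg (walshTransform_weightPow_neg hp0 hp1 hS).le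
        (walshForm_nonneg x hQ.1 S)
  have hle : ∀ m : ℕ, ∀ x : Fin m → Fin n → Fin 2, ∀ Q ∈ nullSumPosSemidef m,
      2 ^ n * (hammingCube n).distortedSum p C x Q ≤
        ∑ S, walshTransform (weightPow p) S * walshForm x Q S := by
    intro m x Q hQ
    rw [← sum_translation_kernel, ← posCoeffSum_sub_negCoeffSum, distortedSum_eq]
    have h1 : 1 ≤ C ^ 2 := one_le_pow₀ hC
    have h2 := mul_le_mul_of_nonneg_right h1 (negCoeffSum_nonneg p x Q)
    exact mul_le_mul_of_nonneg_left (by linarith) (by positivity)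
  refine ⟨fun m _ x _ Q hQ => ?_, fun m _ x hx Q hQ h0 => ?_⟩
  · have h := (hle m x Q hQ).trans (Finset.sum_nonpos fun S _ => hterm m x Q hQ S)
    by_contra hc
    have := mul_pos (pow_pos (two_pos : (0 : ℝ) < 2) n) (not_le.mp hc)
    linarith
  · have h := hle m x Q hQ
    rw [h0, mul_zero] at h
    have hz := (Finset.sum_eq_zero_iff_of_nonpos fun S _ => hterm m x Q hQ S).mp
      (le_antisymm (Finset.sum_nonpos fun S _ => hterm m x Q hQ S) h)
    refine eq_zero_of_walshForm_eq_zero hx hQ.1 fun S => ?_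
    by_cases hS : S = 0
    · rw [hS, walshForm_zero x hQ]
    · exact (mul_eq_zero.mp (hz S (Finset.mem_univ S))).resolve_left
        (walshTransform_weightPow_neg hp0 hp1 hS).ne

/-! ### Necessity: comparing edges with long diagonals -/

/-- The function on the cube whose convolution operator compares the edges with the long
diagonals. -/
noncomputable def diagonalKernel {n : ℕ} (u : Fin n → Fin 2) : ℝ :=
  (n - 1) * (if u = 0 then 1 else 0) - ∑ i, (if u = Pi.single i 1 then 1 else 0) +
    if u = 1 then 1 else 0

lemma walsh_single {n : ℕ} (S : Fin n → Fin 2) (i : Fin n) :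
    walsh S (Pi.single i 1) = bitSign (S i) := by
  rw [walsh, Finset.prod_eq_single i]
  · simp
  · intro j _ hj
    simp [Pi.single_eq_of_ne hj, bitSign_zero]
  · simp

/-- The absolute bound is carried for the induction: a factor `-1` lowers the left side by 2, and `Π
- 2 ≤ -Π` needs `Π ≤ 1`. -/
lemma one_sub_sum_le_prod_bitSign {ι : Type*} (s : Finset ι) (S : ι → Fin 2) :
    1 - ∑ i ∈ s, (1 - bitSign (S i)) ≤ ∏ i ∈ s, bitSign (S i) ∧
      |∏ i ∈ s, bitSign (S i)| ≤ 1 := by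
  classical
  induction s using Finset.induction_on with
  | empty => simp
  | insert a s ha ih =>
    rw [Finset.sum_insert ha, Finset.prod_insert ha]
    obtain ⟨h1, h2⟩ := ih
    have h3 := abs_le.mp h2
    rcases (by unfold bitSign; split_ifs <;> simp : bitSign (S a) = 1 ∨ bitSign (S a) = -1)
      with h | h <;> rw [h]
    · exact ⟨by linarith, by simpa using h2⟩
    · exact ⟨by linarith, by simpa using h2⟩

lemma walshTransform_diagonalKernel {n : ℕ} (S : Fin n → Fin 2) :
    walshTransform diagonalKernel S = (n - 1) - ∑ i, bitSign (S i) + ∏ i, bitSign (S i) := by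
  have h1 : walsh S 1 = ∏ i, bitSign (S i) := by simp [walsh]
  simp only [walshTransform, diagonalKernel, add_mul, sub_mul, Finset.sum_add_distrib,
    Finset.sum_sub_distrib, Finset.sum_mul]
  rw [Finset.sum_comm]
  simp [walsh_single, h1, walsh_zero_right]

lemma walshTransform_diagonalKernel_nonneg {n : ℕ} (S : Fin n → Fin 2) :
    0 ≤ walshTransform diagonalKernel S := by
  rw [walshTransform_diagonalKernel]
  have := (one_sub_sum_le_prod_bitSign Finset.univ S).1
  simp only [Finset.sum_sub_distrib, Finset.sum_const, Finset.card_univ, Fintype.card_fin,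
    nsmul_eq_mul, mul_one] at this
  linarith

lemma posSemidef_diagonalKernel {n m : ℕ} (x : Fin m → Fin n → Fin 2) :
    (Matrix.of fun i j => diagonalKernel (x i + x j)).PosSemidef := by
  refine Matrix.PosSemidef.of_dotProduct_mulVec_nonneg ?_ fun v => ?_
  · ext i j
    simp [add_comm]
  · have h : 2 ^ n * (star v ⬝ᵥ (Matrix.of fun i j => diagonalKernel (x i + x j)).mulVec v) =
        ∑ S, walshTransform diagonalKernel S * (∑ i, walsh S (x i) * v i) ^ 2 := by
      -- On the rank-one matrix `v vᵀ` the Walsh forms are squares, so nonnegative Walsh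
      -- coefficients give semidefiniteness.
      have h1 := sum_translation_kernel x (Matrix.of fun i j => v i * v j) diagonalKernel
      have h2 : ∀ S, walshForm x (Matrix.of fun i j => v i * v j) S =
          (∑ i, walsh S (x i) * v i) ^ 2 := by
        intro S
        rw [sq, Finset.sum_mul_sum]
        exact Finset.sum_congr rfl fun i _ => Finset.sum_congr rfl fun j _ => by
          simp only [Matrix.of_apply]; ring
      simp only [h2] at h1
      rw [← h1]
      simp only [dotProduct, Matrix.mulVec, Finset.mul_sum, star_trivial, Matrix.of_apply]
      exact Finset.sum_congr rfl fun i _ => Finset.sum_congr rfl fun j _ => by ring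
    have h3 : 0 ≤ 2 ^ n *
        (star v ⬝ᵥ (Matrix.of fun i j => diagonalKernel (x i + x j)).mulVec v) := by
      rw [h]
      exact Finset.sum_nonneg fun S _ =>
        mul_nonneg (walshTransform_diagonalKernel_nonneg S) (sq_nonneg _)
    exact nonneg_of_mul_nonneg_right h3 (by positivity)

lemma sum_equiv_add {n m : ℕ} (e : Fin m ≃ (Fin n → Fin 2)) (i : Fin m)
    (f : (Fin n → Fin 2) → ℝ) : ∑ j, f (e i + e j) = ∑ u, f u := by
  rw [e.sum_comp fun y => f (e i + y)]
  exact Equiv.sum_comp (Equiv.addLeft (e i)) f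

lemma sum_diagonalKernel {n : ℕ} : ∑ u : Fin n → Fin 2, diagonalKernel u = 0 := by
  have h := walshTransform_diagonalKernel (0 : Fin n → Fin 2)
  simp only [walshTransform, walsh_zero_left, mul_one, Pi.zero_apply, bitSign_zero] at h
  rw [h]
  simp

lemma diagonalKernel_mem {n m : ℕ} (e : Fin m ≃ (Fin n → Fin 2)) :
    (Matrix.of fun i j => diagonalKernel (e i + e j)) ∈ nullSumPosSemidef m := by
  refine ⟨posSemidef_diagonalKernel e, funext fun i => ?_⟩
  simp only [Matrix.mulVec, dotProduct, Matrix.of_apply, mul_one, Pi.zero_apply]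
  rw [sum_equiv_add e i, sum_diagonalKernel]

lemma hammingWeight_one {n : ℕ} : hammingWeight (1 : Fin n → Fin 2) = n := by
  simp [hammingWeight]

lemma hammingWeight_single {n : ℕ} (i : Fin n) :
    hammingWeight (Pi.single i 1 : Fin n → Fin 2) = 1 := by
  rw [hammingWeight, Finset.sum_eq_single i]
  · simp
  · intro j _ hj
    simp [Pi.single_eq_of_ne hj]
  · simp

lemma one_ne_zero_cube {n : ℕ} (hn : 2 ≤ n) : (1 : Fin n → Fin 2) ≠ 0 := fun h => by
  have := congrFun h ⟨0, by omega⟩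
  simp at this

lemma diagonalKernel_one {n : ℕ} (hn : 2 ≤ n) : diagonalKernel (1 : Fin n → Fin 2) = 1 := by
  have h : ∀ i, (1 : Fin n → Fin 2) ≠ Pi.single i 1 := fun i h => by
    have := congrArg hammingWeight h
    rw [hammingWeight_one, hammingWeight_single] at this
    omega
  simp [diagonalKernel, one_ne_zero_cube hn, h]

lemma weightPow_mul_max_diagonalKernel_neg {n : ℕ} (hn : 2 ≤ n) (p : ℝ) (u : Fin n → Fin 2) :
    weightPow p u * max (-diagonalKernel u) 0 ≤ ∑ i, if u = Pi.single i 1 then 1 else 0 := by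
  have hnn : (0 : ℝ) ≤ ∑ i, if u = Pi.single i 1 then 1 else 0 :=
    Finset.sum_nonneg fun i _ => by split_ifs <;> norm_num
  have hn' : (2 : ℝ) ≤ n := by exact_mod_cast hn
  by_cases h : ∃ i, u = Pi.single i 1
  · obtain ⟨i, rfl⟩ := h
    have hw : weightPow p (Pi.single i 1 : Fin n → Fin 2) = 1 := by
      have : (Pi.single i 1 : Fin n → Fin 2) ≠ 0 := fun h => by
        have := (hammingWeight_eq_zero_iff _).mpr h
        rw [hammingWeight_single] at this
        omega
      rw [weightPow, if_neg this, hammingWeight_single, Nat.cast_one, Real.one_rpow]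
    rw [hw, one_mul]
    refine max_le ?_ hnn
    unfold diagonalKernel
    split_ifs <;> linarith
  · push Not at h
    have h0 : (∑ i, if u = Pi.single i 1 then (1 : ℝ) else 0) = 0 :=
      Finset.sum_eq_zero fun i _ => if_neg (h i)
    have h1 : 0 ≤ diagonalKernel u := by
      unfold diagonalKernel
      rw [h0]
      split_ifs <;> linarith
    rw [h0, max_eq_right (by linarith), mul_zero]

lemma distortedSum_diagonalKernel_nonneg {n m : ℕ} (hn : 2 ≤ n) {p C : ℝ}
    (hC : C ^ 2 ≤ (n : ℝ) ^ (p - 1)) (e : Fin m ≃ (Fin n → Fin 2)) :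
    0 ≤ (hammingCube n).distortedSum p C e
      (Matrix.of fun i j => diagonalKernel (e i + e j)) := by
  have hn' : (0 : ℝ) < n := by exact_mod_cast (by omega : 0 < n)
  rw [distortedSum_eq]
  simp only [posCoeffSum, negCoeffSum, Matrix.of_apply]
  rw [Finset.mul_sum, ← Finset.sum_sub_distrib]
  refine Finset.sum_nonneg fun i _ => ?_
  rw [sum_equiv_add e i fun u => weightPow p u * max (diagonalKernel u) 0,
    sum_equiv_add e i fun u => weightPow p u * max (-diagonalKernel u) 0]
  -- The antipode alone contributes `n ^ p`; the negative entries are the `n` edges, of length 1.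
  have h1 : (n : ℝ) ^ p ≤ ∑ u : Fin n → Fin 2, weightPow p u * max (diagonalKernel u) 0 := by
    have h := Finset.single_le_sum (f := fun u : Fin n → Fin 2 =>
      weightPow p u * max (diagonalKernel u) 0)
      (fun u _ => mul_nonneg (weightPow_nonneg p u) (le_max_right _ _))
      (Finset.mem_univ (1 : Fin n → Fin 2))
    simpa [diagonalKernel_one hn, weightPow, one_ne_zero_cube hn, hammingWeight_one] using h
  have h2 : ∑ u : Fin n → Fin 2, weightPow p u * max (-diagonalKernel u) 0 ≤ n := by
    refine (Finset.sum_le_sum fun u _ => weightPow_mul_max_diagonalKernel_neg hn p u).trans ?_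
    rw [Finset.sum_comm]
    simp
  have h3 : (n : ℝ) ^ p = (n : ℝ) ^ (p - 1) * n := by
    rw [← Real.rpow_add_one hn'.ne']; ring_nf
  have h4 := mul_le_mul_of_nonneg_left h2 (sq_nonneg C)
  have h5 := mul_le_mul_of_nonneg_right hC hn'.le
  linarith

lemma not_hasStrictNegType {n : ℕ} (hn : 2 ≤ n) {p C : ℝ} (hC : C ^ 2 ≤ (n : ℝ) ^ (p - 1)) :
    ¬ (hammingCube n).HasStrictNegType p C := by
  rintro ⟨h1, h2⟩
  have e := (Fintype.equivFin (Fin n → Fin 2)).symm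
  have hm : 2 ≤ Fintype.card (Fin n → Fin 2) := by
    simpa using Nat.pow_le_pow_right two_pos (by omega : 1 ≤ n)
  have h3 := h2 _ hm e e.injective _ (diagonalKernel_mem e)
    (le_antisymm (h1 _ hm e e.injective _ (diagonalKernel_mem e))
      (distortedSum_diagonalKernel_nonneg hn hC e))
  -- The entry at an antipodal pair is `1`, so the matrix is nonzero.
  have h4 := congrFun (congrFun h3 (e.symm 0)) (e.symm 1)
  simp [diagonalKernel_one hn] at h4

theorem corollary4p9 (n : ℕ) (hn : 2 ≤ n) (p C : ℝ) (hp : 0 ≤ p) (hC : 1 ≤ C) :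
    (hammingCube n).HasStrictNegType p C ↔
      p < 1 ∨ (1 ≤ p ∧ C > (n : ℝ) ^ ((p - 1) / 2)) := by
  have hsq : ((n : ℝ) ^ ((p - 1) / 2)) ^ 2 = (n : ℝ) ^ (p - 1) := by
    rw [← Real.rpow_natCast, ← Real.rpow_mul n.cast_nonneg]
    norm_num
  have hnn : (0 : ℝ) ≤ (n : ℝ) ^ ((p - 1) / 2) := by positivity
  constructor
  · intro h
    rcases lt_or_ge p 1 with hp1 | hp1
    · exact Or.inl hp1
    · refine Or.inr ⟨hp1, ?_⟩
      by_contra hc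
      refine not_hasStrictNegType hn ?_ h
      rw [← hsq]
      exact pow_le_pow_left₀ (by linarith) (not_lt.mp hc) 2
  · rintro (hp1 | ⟨hp1, hc⟩)
    · exact hasStrictNegType_of_lt_one hp hp1 hC
    · refine hasStrictNegType_of_one_le hp1 ?_
      rw [← hsq]
      exact pow_lt_pow_left₀ hc hnn two_ne_zero
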